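/- For positive integers $m,d$, a finite non-empty subset $X$ of the unit sphere $S^{d-1}\subset\mathbb{R}^d$ is called an $m$-stiff configuration if (i) $X$ is a spherical $(2m-1)$-design, that is, $$\frac{1}{|X|}\sum_{x\in X} f(x)=\frac{1}{|S^{d-1}|}\int_{S^{d-1}} f(x)\,dx$$ for every real polynomial $f$ in $d$ variables of degree at most $2m-1$, where the integral is with respect to the surface measure and $|S^{d-1}|$ is the total surface measure of the sphere; and (ii) there is a point $z\in S^{d-1}$ such that the set $\{\langle z,x\rangle : x\in X\}$ has at most $m$ elements. Theorem. Let $n\ge 1$ be an integer. There exists a $2n$-stiff configuration in $S^{3}\subset\mathbb{R}^4$ if and only if $n=1$. -/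

import Mathlib

noncomputable section

/-- `X` is a spherical `t`-design in the unit sphere `S^{d-1}` of `ℝ^d`: a non-empty finite set of
unit vectors such that, for every real polynomial `f` in `d` variables of total degree at most `t`,
the average of `f` over `X` equals the average of `f` over the sphere with respect to the
surface measure. -/
def IsSphericalDesign {d : ℕ} (t : ℕ) (X : Finset (EuclideanSpace ℝ (Fin d))) : Prop :=
  X.Nonempty ∧
  (∀ x ∈ X, x ∈ Metric.sphere (0 : EuclideanSpace ℝ (Fin d)) 1) ∧
  ∀ f : MvPolynomial (Fin d) ℝ, f.totalDegree ≤ t →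
    (1 / (X.card : ℝ)) * ∑ x ∈ X, MvPolynomial.eval (fun i => x i) f =
      (1 / (MeasureTheory.volume : MeasureTheory.Measure
          (EuclideanSpace ℝ (Fin d))).toSphere.real Set.univ) *
        ∫ x : Metric.sphere (0 : EuclideanSpace ℝ (Fin d)) 1,
          MvPolynomial.eval (fun i => (x : EuclideanSpace ℝ (Fin d)) i) f
          ∂(MeasureTheory.volume : MeasureTheory.Measure (EuclideanSpace ℝ (Fin d))).toSphere

/-- The set `D(z, X) = {⟨z, x⟩ : x ∈ X}` of inner products. -/
def innerProducts {d : ℕ} (z : EuclideanSpace ℝ (Fin d))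
    (X : Finset (EuclideanSpace ℝ (Fin d))) : Finset ℝ :=
  X.image (fun x => inner ℝ z x)

/-- The set `𝒟_m(X)` of those points `z` of the unit sphere with `|D(z, X)| ≤ m`. -/
def stiffPoles {d : ℕ} (m : ℕ) (X : Finset (EuclideanSpace ℝ (Fin d))) :
    Set (EuclideanSpace ℝ (Fin d)) :=
  {z | z ∈ Metric.sphere (0 : EuclideanSpace ℝ (Fin d)) 1 ∧ (innerProducts z X).card ≤ m}

/-- `X` is an `m`-stiff configuration in `S^{d-1}` (for `m ≥ 1`): a spherical `(2m-1)`-design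
such that `𝒟_m(X)` is non-empty. -/
def IsStiff {d : ℕ} (m : ℕ) (X : Finset (EuclideanSpace ℝ (Fin d))) : Prop :=
  IsSphericalDesign (2 * m - 1) X ∧ (stiffPoles m X).Nonempty

end

/-! Projecting the surface measure of `S³` onto a line gives the semicircle law, whose orthonormal
polynomials are the Chebyshev polynomials `U`. If `z` is a pole of a `2n`-stiff `X`, the values `⟨z,
x⟩`, weighted by their frequencies in `X`, form a quadrature rule with at most `2n` nodes, exact up
to degree `4n - 1`. By `IsSemicircular.quadrature` it is the Gauss rule: the nodes `t` are roots of
`U_{2n}`, and by `sum_U_sq_of_root` the weights are `2 (1 - t²) / (2n + 1)`.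

Frequencies are rational, hence so is `t²`. Since `2t` is twice the cosine of a rational multiple of
`π`, `4t²` is a rational algebraic integer in `[0, 4)`; `sq_eq_of_U_root_of_even` leaves only `4t² =
1`. So there are at most two nodes, while the Gauss rule has `2n`, forcing `n = 1`. For `n = 1` the
cross-polytope works, with the pole `(1/2, 1/2, 1/2, 1/2)`. -/

/-! ### Gaussian moments and monomial integrals over the sphere. -/

open MeasureTheory Set in
/-- Polar coordinates for a positively homogeneous function times a Gaussian. -/
theorem integral_mul_exp_neg_norm_sq_of_homogeneous {E : Type*} [NormedAddCommGroup E]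
    [NormedSpace ℝ E] [Nontrivial E] [FiniteDimensional ℝ E] [MeasurableSpace E] [BorelSpace E]
    (μ : Measure E) [μ.IsAddHaarMeasure] (f : E → ℝ) (k : ℕ)
    (hf : ∀ (r : ℝ) (x : E), f (r • x) = r ^ k * f x) :
    ∫ x, f x * Real.exp (-‖x‖ ^ 2) ∂μ =
      (∫ x : Metric.sphere (0 : E) 1, f x ∂μ.toSphere) *
        ∫ r in Ioi (0 : ℝ), r ^ (Module.finrank ℝ E - 1 + k) * Real.exp (-r ^ 2) := by
  calc
    ∫ x, f x * Real.exp (-‖x‖ ^ 2) ∂μ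
      = ∫ x : ({(0)}ᶜ : Set E), f x * Real.exp (-‖x.1‖ ^ 2) ∂(μ.comap (↑)) := by
      rw [integral_subtype_comap (measurableSet_singleton _).compl
        fun x ↦ f x * Real.exp (-‖x‖ ^ 2), restrict_compl_singleton]
    _ = ∫ x : Metric.sphere (0 : E) 1 × Ioi (0 : ℝ),
          f x.1 * (x.2.1 ^ k * Real.exp (-x.2.1 ^ 2))
          ∂μ.toSphere.prod (.volumeIoiPow (Module.finrank ℝ E - 1)) := by
      rw [← μ.measurePreserving_homeomorphUnitSphereProd.integral_comp
        (Homeomorph.measurableEmbedding _)]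
      refine integral_congr_ae (.of_forall fun x ↦ ?_)
      have hx : ‖x.1‖ ≠ 0 := norm_ne_zero_iff.2 x.2
      have h := hf ‖x.1‖ (‖x.1‖⁻¹ • x.1)
      rw [smul_inv_smul₀ hx] at h
      simp only [homeomorphUnitSphereProd_apply_fst_coe, homeomorphUnitSphereProd_apply_snd_coe]
      rw [h]
      ring
    _ = (∫ x : Metric.sphere (0 : E) 1, f x ∂μ.toSphere) *
          ∫ x : Ioi (0 : ℝ), x.1 ^ k * Real.exp (-x.1 ^ 2)
            ∂.volumeIoiPow (Module.finrank ℝ E - 1) :=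
      integral_prod_mul (fun x : Metric.sphere (0 : E) 1 ↦ f x)
        (fun x : Ioi (0 : ℝ) ↦ x.1 ^ k * Real.exp (-x.1 ^ 2))
    _ = _ := by
      congr 1
      simp only [Measure.volumeIoiPow, ENNReal.ofReal]
      rw [integral_withDensity_eq_integral_smul,
        integral_subtype_comap measurableSet_Ioi fun a ↦
          Real.toNNReal (a ^ (Module.finrank ℝ E - 1)) • (a ^ k * Real.exp (-a ^ 2)),
        setIntegral_congr_fun measurableSet_Ioi fun x hx ↦ ?_]
      · rw [NNReal.smul_def, Real.coe_toNNReal _ (pow_nonneg hx.out.le _), smul_eq_mul, pow_add,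
          mul_assoc]
      · exact (measurable_subtype_coe.pow_const _).real_toNNReal

/-- The `k`-th moment of the Gaussian on the positive half-line. -/
noncomputable def radialMoment (k : ℕ) : ℝ :=
  ∫ r in Set.Ioi (0 : ℝ), r ^ k * Real.exp (-r ^ 2)

theorem radialMoment_eq (k : ℕ) : radialMoment k = 1 / 2 * Real.Gamma ((k + 1) / 2) := by
  rw [radialMoment, ← integral_rpow_mul_exp_neg_rpow two_pos
    (lt_of_lt_of_le (by norm_num) (Nat.cast_nonneg k))]
  simp only [Real.rpow_natCast, Real.rpow_ofNat]

theorem radialMoment_pos (k : ℕ) : 0 < radialMoment k := by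
  rw [radialMoment_eq]
  have := Real.Gamma_pos_of_pos (s := ((k : ℝ) + 1) / 2) (by positivity)
  positivity

theorem radialMoment_add_two (k : ℕ) :
    radialMoment (k + 2) = (k + 1) / 2 * radialMoment k := by
  rw [radialMoment_eq, radialMoment_eq]
  have h := Real.Gamma_add_one (s := ((k : ℝ) + 1) / 2) (by positivity)
  rw [show ((↑(k + 2) : ℝ) + 1) / 2 = (k + 1) / 2 + 1 by push_cast; ring, h]
  ring

/-- The `k`-th moment of the Gaussian on the line. -/
noncomputable def gaussMoment (k : ℕ) : ℝ := ∫ x : ℝ, x ^ k * Real.exp (-x ^ 2)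

theorem gaussMoment_of_odd {k : ℕ} (hk : Odd k) : gaussMoment k = 0 := by
  have h := MeasureTheory.integral_neg_eq_self (fun x : ℝ ↦ x ^ k * Real.exp (-x ^ 2)) MeasureTheory.volume
  simp only [hk.neg_pow, neg_mul, MeasureTheory.integral_neg, even_two.neg_pow] at h
  rw [gaussMoment]
  linarith

theorem gaussMoment_of_even {k : ℕ} (hk : Even k) : gaussMoment k = 2 * radialMoment k := by
  have h := integral_comp_abs (f := fun x : ℝ ↦ x ^ k * Real.exp (-x ^ 2))
  rw [gaussMoment, radialMoment]
  simpa only [hk.pow_abs, sq_abs] using h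

theorem gaussMoment_add_two (k : ℕ) : gaussMoment (k + 2) = (k + 1) / 2 * gaussMoment k := by
  rcases Nat.even_or_odd k with hk | hk
  · rw [gaussMoment_of_even hk, gaussMoment_of_even (hk.add even_two), radialMoment_add_two]
    ring
  · rw [gaussMoment_of_odd hk, gaussMoment_of_odd (hk.add_even even_two), mul_zero]

open MeasureTheory in
/-- Moments of the surface measure in orthonormal coordinates. -/
theorem integral_sphere_prod_pow {ι : Type*} [Fintype ι] [Nonempty ι]
    {E : Type*} [NormedAddCommGroup E] [InnerProductSpace ℝ E]
    [MeasurableSpace E] [BorelSpace E] [FiniteDimensional ℝ E]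
    (b : OrthonormalBasis ι ℝ E) (s : ι → ℕ) :
    (∫ x : Metric.sphere (0 : E) 1, ∏ i, inner ℝ (b i) (x : E) ^ s i
        ∂(volume : Measure E).toSphere) *
      radialMoment (Fintype.card ι - 1 + ∑ i, s i) = ∏ i, gaussMoment (s i) := by
  have : Nontrivial E := nontrivial_of_ne _ _ (b.orthonormal.ne_zero (Classical.arbitrary ι))
  have h := integral_mul_exp_neg_norm_sq_of_homogeneous (volume : Measure E)
    (fun x ↦ ∏ i, inner ℝ (b i) x ^ s i) (∑ i, s i) (fun r x ↦ by
      simp [inner_smul_right, mul_pow, Finset.prod_mul_distrib, Finset.prod_pow_eq_pow_sum])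
  rw [Module.finrank_eq_card_basis b.toBasis] at h
  -- In the coordinates of `b` the Gaussian factors, so the integral splits into one-dimensional
  -- moments.
  rw [radialMoment, ← h, ← b.measurePreserving_repr_symm.integral_comp
    b.repr.symm.toHomeomorph.measurableEmbedding,
    ← (PiLp.volume_preserving_toLp ι).integral_comp
    (MeasurableEquiv.toLp 2 (ι → ℝ)).measurableEmbedding]
  simp only [gaussMoment]
  rw [← integral_fintype_prod_volume_eq_prod]
  refine integral_congr_ae (.of_forall fun x ↦ ?_)
  simp only [LinearIsometryEquiv.norm_map, EuclideanSpace.norm_sq_eq, ← b.repr_apply_apply,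
    LinearIsometryEquiv.apply_symm_apply, Real.norm_eq_abs, sq_abs, Finset.prod_mul_distrib,
    ← Real.exp_sum, Finset.sum_neg_distrib]

/-! ### Chebyshev orthogonality and Gauss quadrature for the semicircle law. -/

/-- A functional whose moments are those of the semicircle law on `[-1, 1]`. -/
structure IsSemicircular (L : Polynomial ℝ →ₗ[ℝ] ℝ) : Prop where
  map_one : L 1 = 1
  map_X : L Polynomial.X = 0
  map_X_pow : ∀ k : ℕ, (k + 4) * L (Polynomial.X ^ (k + 2)) = (k + 1) * L (Polynomial.X ^ k)

namespace IsSemicircular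

open Polynomial Polynomial.Chebyshev

variable {L : Polynomial ℝ →ₗ[ℝ] ℝ}

/-- Integration by parts against the weight `(1 - x ^ 2) ^ (1 / 2)`. -/
theorem map_derivative (hL : IsSemicircular L) (q : ℝ[X]) :
    L ((1 - X ^ 2) * derivative q - 3 * X * q) = 0 := by
  induction q using Polynomial.induction_on' with
  | add p q hp hq =>
    rw [← add_zero (0 : ℝ)]
    nth_rewrite 1 [← hp]
    rw [← hq, ← map_add, derivative_add]
    congr 1
    ring
  | monomial n a =>
    rw [← C_mul_X_pow_eq_monomial]
    rcases n with _ | k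
    · have h : (1 - X ^ 2) * derivative (C a * X ^ 0) - 3 * X * (C a * X ^ 0)
          = (-3 * a) • (X : ℝ[X]) := by
        simp only [pow_zero, mul_one, derivative_C, mul_zero, zero_sub, smul_eq_C_mul, map_mul, map_neg,
          map_ofNat]
        ring
      rw [h, map_smul, hL.map_X, smul_zero]
    · have h : (1 - X ^ 2) * derivative (C a * X ^ (k + 1)) - 3 * X * (C a * X ^ (k + 1))
          = (a * (k + 1)) • (X ^ k : ℝ[X]) - (a * (k + 4)) • (X ^ (k + 2) : ℝ[X]) := by
        simp only [derivative_C_mul, derivative_X_pow, smul_eq_C_mul, map_mul, map_add, map_natCast,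
          Nat.add_sub_cancel, Nat.cast_add, Nat.cast_one, _root_.map_one, map_ofNat]
        ring
      rw [h, map_sub, map_smul, map_smul, smul_eq_mul, smul_eq_mul, mul_assoc, mul_assoc,
        hL.map_X_pow, sub_self]

/-- Sturm–Liouville argument: `map_derivative` is applied to the Wronskian of `U i` and `U j`, and
the eigenvalues `i (i + 2)` and `j (j + 2)` are distinct. -/
theorem map_U_mul_U_of_ne (hL : IsSemicircular L) {i j : ℕ} (hij : i ≠ j) :
    L (U ℝ i * U ℝ j) = 0 := by
  have h := hL.map_derivative (derivative (U ℝ i) * U ℝ j - U ℝ i * derivative (U ℝ j))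
  have hi := one_sub_X_sq_mul_derivative_derivative_U_eq_poly_in_U (R := ℝ) i
  have hj := one_sub_X_sq_mul_derivative_derivative_U_eq_poly_in_U (R := ℝ) j
  simp only [Function.iterate_succ, Function.iterate_zero, Function.comp_apply, id_eq] at hi hj
  have e : (1 - X ^ 2) * derivative (derivative (U ℝ i) * U ℝ j - U ℝ i * derivative (U ℝ j)) -
      3 * X * (derivative (U ℝ i) * U ℝ j - U ℝ i * derivative (U ℝ j)) =
      (((j : ℝ) + 2) * j - (i + 2) * i) • (U ℝ i * U ℝ j) := by
    simp only [derivative_mul, smul_eq_C_mul, map_sub, map_mul, map_add, map_natCast,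
      map_ofNat]
    push_cast at hi hj
    linear_combination U ℝ j * hi - U ℝ i * hj
  rw [e, map_smul, smul_eq_mul] at h
  refine (mul_eq_zero.1 h).resolve_left fun h0 ↦ hij ?_
  have : ((j : ℝ) - i) * (j + i + 2) = 0 := by linear_combination h0
  rcases mul_eq_zero.1 this with h1 | h1
  · exact_mod_cast (sub_eq_zero.1 h1).symm
  · have : (0 : ℝ) < j + i + 2 := by positivity
    exact absurd h1 this.ne'

/-- Reduces the normalisation of `U (n + 1)` to the orthogonality of `U n` and `U (n + 2)`. -/
theorem U_add_one_sq (n : ℤ) : U ℝ (n + 1) ^ 2 = 1 + U ℝ n * U ℝ (n + 2) := by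
  induction n using Int.induction_on with
  | zero => simp [U_two]; ring
  | succ n ih =>
    have h1 := U_add_two ℝ (n : ℤ)
    have h2 := U_add_two ℝ (n + 1 : ℤ)
    rw [show (n : ℤ) + 1 + 1 = n + 2 by ring] at *
    rw [h2]
    linear_combination ih + U ℝ (n + 2 : ℤ) * h1
  | pred n ih =>
    have h1 := U_add_two ℝ (-n - 1 : ℤ)
    have h2 := U_add_two ℝ (-n : ℤ)
    rw [show (-n : ℤ) - 1 + 1 = -n by ring, show (-n : ℤ) - 1 + 2 = -n + 1 by ring] at *
    linear_combination ih - U ℝ (-n + 1 : ℤ) * h1 + U ℝ (-n : ℤ) * h2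

theorem map_U_mul_U (hL : IsSemicircular L) (i j : ℕ) :
    L (U ℝ i * U ℝ j) = if i = j then 1 else 0 := by
  split_ifs with h
  · subst h
    rcases i with _ | i
    · simp [hL.map_one]
    · have h := U_add_one_sq (i : ℤ)
      have h2 := hL.map_U_mul_U_of_ne (i := i) (j := i + 2) (by omega)
      push_cast at h2 ⊢
      rw [← sq, h, map_add, hL.map_one, h2, add_zero]
  · exact hL.map_U_mul_U_of_ne h

/-- A quadrature formula with at most `m` nodes, exact up to degree `2 * m - 1`, is the
Gauss formula. -/
theorem quadrature (hL : IsSemicircular L) {m : ℕ} (D : Finset ℝ) (hD : D.card ≤ m) (w : ℝ → ℝ)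
    (h : ∀ p : ℝ[X], p.natDegree ≤ 2 * m - 1 → ∑ t ∈ D, w t * p.eval t = L p) :
    D.card = m ∧ ∀ t ∈ D, (U ℝ m).eval t = 0 ∧
      w t * ∑ j ∈ Finset.range m, (U ℝ j).eval t ^ 2 = 1 := by
  have hU : ∀ i j : ℕ, i ≤ m → j < m →
      ∑ t ∈ D, w t * ((U ℝ i).eval t * (U ℝ j).eval t) = if i = j then 1 else 0 := by
    intro i j hi hj
    rw [← hL.map_U_mul_U, ← h]
    · simp only [eval_mul]
    · refine natDegree_mul_le.trans ?_
      rw [natDegree_U_natCast, natDegree_U_natCast]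
      omega
  -- Orthonormality of `U 0, …, U (m - 1)` on the nodes reads `A * B = 1`. The rank then forces `m`
  -- nodes, so the matrices are square and `B * A = 1`, whose diagonal gives the weights.
  let A : Matrix (Fin m) D ℝ := .of fun j t ↦ (U ℝ (j : ℕ)).eval t.1
  let B : Matrix D (Fin m) ℝ := .of fun t j ↦ w t * (U ℝ (j : ℕ)).eval t.1
  have hAB : A * B = 1 := by
    ext i j
    rw [Matrix.mul_apply, Matrix.one_apply]
    have := hU i j i.2.le j.2
    rw [← Finset.sum_coe_sort D] at this
    simp only [Fin.ext_iff, ← this, A, B, Matrix.of_apply]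
    exact Finset.sum_congr rfl fun t _ ↦ by ring
  have hcard : D.card = m := by
    refine le_antisymm hD ?_
    have h1 := Matrix.rank_mul_le_left A B
    rw [hAB, Matrix.rank_one, Fintype.card_fin] at h1
    simpa using h1.trans (Matrix.rank_le_card_width A)
  have hBA : B * A = 1 := (Matrix.mul_eq_one_comm_of_card_eq _ _ _ (by simp [hcard])).1 hAB
  refine ⟨hcard, fun t ht ↦ ⟨?_, ?_⟩⟩
  -- Products `U m * U j` with `j < m` have degree at most `2 * m - 1`, so the rule still sees their
  -- orthogonality; as `B` is invertible, `U m` vanishes at every node.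
  · let v : D → ℝ := fun t ↦ (U ℝ m).eval t.1
    have hv : Matrix.vecMul v B = 0 := by
      ext j
      have := hU m j le_rfl j.2
      rw [if_neg j.2.ne', ← Finset.sum_coe_sort D] at this
      rw [Pi.zero_apply, ← this]
      simp only [Matrix.vecMul, dotProduct, v, B, Matrix.of_apply]
      exact Finset.sum_congr rfl fun t _ ↦ by ring
    have : Matrix.vecMul v (B * A) = 0 := by rw [← Matrix.vecMul_vecMul, hv, Matrix.zero_vecMul]
    rw [hBA, Matrix.vecMul_one] at this
    exact congrFun this ⟨t, ht⟩
  · have := congrFun (congrFun hBA ⟨t, ht⟩) ⟨t, ht⟩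
    rw [Matrix.mul_apply, Matrix.one_apply_eq] at this
    rw [← this, Finset.mul_sum, ← Fin.sum_univ_eq_sum_range fun j : ℕ ↦ w t * (U ℝ j).eval t ^ 2]
    simp only [A, B, Matrix.of_apply]
    exact Finset.sum_congr rfl fun t _ ↦ by ring

end IsSemicircular

/-! ### Christoffel sums, and roots of `U_{2n}` with rational square. -/

open Polynomial Polynomial.Chebyshev in
/-- The Christoffel-Darboux sum at a node of the Gauss formula. -/
theorem sum_U_sq_of_root {m : ℕ} {t : ℝ} (ht : (U ℝ m).eval t = 0) :
    2 * (1 - t ^ 2) * ∑ j ∈ Finset.range m, (U ℝ j).eval t ^ 2 = m + 1 := by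
  -- The second identity is a quadratic form preserved by the three-term recurrence; it feeds the
  -- induction for the first. The integer index `k - 1` lets the base case use `U (-1) = 0`.
  have key : ∀ k : ℕ, 4 * (1 - t ^ 2) * ∑ j ∈ Finset.range k, (U ℝ j).eval t ^ 2 =
      2 * k + 1 - (U ℝ k).eval t ^ 2 + (U ℝ (k - 1 : ℤ)).eval t ^ 2 ∧
      (U ℝ k).eval t ^ 2 - 2 * t * (U ℝ k).eval t * (U ℝ (k - 1 : ℤ)).eval t +
        (U ℝ (k - 1 : ℤ)).eval t ^ 2 = 1 := by
    intro k
    induction k with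
    | zero => simp
    | succ k ih =>
      obtain ⟨h1, h2⟩ := ih
      have h3 : (U ℝ (k + 1 : ℤ)).eval t =
          2 * t * (U ℝ k).eval t - (U ℝ (k - 1 : ℤ)).eval t := by
        rw [U_add_one]
        simp
      push_cast
      rw [add_sub_cancel_right, Finset.sum_range_succ, h3]
      exact ⟨by linear_combination h1 + 2 * h2, by linear_combination h2⟩
  obtain ⟨h1, h2⟩ := key m
  rw [ht] at h1 h2
  linear_combination h1 / 2 + h2 / 2

open Polynomial Polynomial.Chebyshev in
/-- A root of a Chebyshev polynomial of the second kind of even degree whose square is rational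
is one of `1 / 2`, `-1 / 2`. -/
theorem sq_eq_of_U_root_of_even {n : ℕ} {t : ℝ} (ht : (U ℝ ((2 * n : ℕ) : ℤ)).eval t = 0)
    (h1 : t ^ 2 < 1) (hq : ∃ q : ℚ, t ^ 2 = q) : t ^ 2 = 1 / 4 := by
  have hlt := (sq_lt_one_iff_abs_lt_one t).1 h1
  rw [abs_lt] at hlt
  have hint : IsIntegral ℤ (2 * t) := by
    have hs := U_real_cos (Real.arccos t) ((2 * n : ℕ) : ℤ)
    rw [Real.cos_arccos hlt.1.le hlt.2.le, ht, zero_mul, eq_comm, Real.sin_eq_zero_iff] at hs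
    obtain ⟨k, hk⟩ := hs
    have hpos : ((2 * n : ℕ) : ℝ) + 1 ≠ 0 := by positivity
    have harc : Real.arccos t = ((k / ((2 * n : ℕ) + 1) : ℚ) : ℝ) * Real.pi := by
      push_cast at hk hpos ⊢
      field_simp
      linear_combination -hk
    rw [← Real.cos_arccos hlt.1.le hlt.2.le, harc]
    exact Real.isIntegral_two_mul_cos_rat_mul_pi _
  obtain ⟨k, hk⟩ : ∃ k : ℤ, (2 * t) ^ 2 = k := by
    refine (IsIntegral.exists_int_iff_exists_rat (hint.pow 2)).1 ?_
    obtain ⟨q, hq⟩ := hq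
    exact ⟨4 * q, by push_cast; rw [← hq]; ring⟩
  have hk0 : 0 ≤ k := by exact_mod_cast hk ▸ sq_nonneg (2 * t)
  have hk4 : k < 4 := by
    have : (k : ℝ) < 4 := by rw [← hk]; nlinarith
    exact_mod_cast this
  have hk' : t ^ 2 = k / 4 := by linear_combination hk / 4
  -- The even-index values satisfy a recurrence involving `t` only through `k = 4 t²`.
  let e : ℕ → ℝ := fun n ↦ (U ℝ ((2 * n : ℕ) : ℤ)).eval t
  have hrec : ∀ n, e (n + 2) = (k - 2) * e (n + 1) - e n := by
    intro n
    have a1 := congrArg (eval t) (U_add_two ℝ ((2 * n : ℕ) : ℤ))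
    have a2 := congrArg (eval t) (U_add_two ℝ ((2 * n + 1 : ℕ) : ℤ))
    have a3 := congrArg (eval t) (U_add_two ℝ ((2 * n + 2 : ℕ) : ℤ))
    simp only [eval_sub, eval_mul, eval_ofNat, eval_X] at a1 a2 a3
    simp only [e, ← hk]
    rw [show 2 * (n + 2) = 2 * n + 4 by ring, show 2 * (n + 1) = 2 * n + 2 by ring]
    push_cast at a1 a2 a3 ⊢
    ring_nf at a1 a2 a3 ⊢
    linear_combination a3 + 2 * t * a2 + a1
  have h0 : e 0 = 1 := by simp [e]
  have hh1 : e 1 = k - 1 := by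
    simp only [e, mul_one, Nat.cast_ofNat, U_two, eval_sub, eval_mul, eval_pow, eval_X, eval_one,
      eval_ofNat, ← hk]
    ring
  change e n = 0 at ht
  -- For `k = 0, 2, 3` the recurrence is periodic and the pairs `(e n, e (n + 1))` run through a
  -- finite set avoiding zero; `k = 1` is the desired value.
  interval_cases k
  · have : ∀ n, (e n = 1 ∧ e (n + 1) = -1) ∨ (e n = -1 ∧ e (n + 1) = 1) := by
      intro n
      induction n with
      | zero => left; norm_num [h0, hh1]
      | succ n ih =>
        rw [hrec]
        rcases ih with ⟨a, b⟩ | ⟨a, b⟩ <;> norm_num [a, b]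
    rcases this n with ⟨a, _⟩ | ⟨a, _⟩ <;> norm_num [a] at ht
  · rw [hk']; norm_num
  · have : ∀ n, (e n = 1 ∨ e n = -1) ∧ (e (n + 1) = 1 ∨ e (n + 1) = -1) := by
      intro n
      induction n with
      | zero => norm_num [h0, hh1]
      | succ n ih =>
        rw [hrec]
        rcases ih with ⟨a | a, b | b⟩ <;> norm_num [a, b]
    rcases this n with ⟨a | a, _⟩ <;> norm_num [a] at ht
  · have : ∀ n, (e n = 1 ∧ e (n + 1) = 2) ∨ (e n = 2 ∧ e (n + 1) = 1) ∨
        (e n = 1 ∧ e (n + 1) = -1) ∨ (e n = -1 ∧ e (n + 1) = -2) ∨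
        (e n = -2 ∧ e (n + 1) = -1) ∨ (e n = -1 ∧ e (n + 1) = 1) := by
      intro n
      induction n with
      | zero => left; norm_num [h0, hh1]
      | succ n ih =>
        rw [hrec]
        rcases ih with ⟨a, b⟩ | ⟨a, b⟩ | ⟨a, b⟩ | ⟨a, b⟩ | ⟨a, b⟩ | ⟨a, b⟩ <;> norm_num [a, b]
    rcases this n with ⟨a, _⟩ | ⟨a, _⟩ | ⟨a, _⟩ | ⟨a, _⟩ | ⟨a, _⟩ | ⟨a, _⟩ <;> norm_num [a] at ht

/-! ### Zonal averages on `S³` follow the semicircle law. -/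

open MeasureTheory in
theorem integrable_toSphere_of_continuous {E : Type*} [NormedAddCommGroup E] [NormedSpace ℝ E]
    [FiniteDimensional ℝ E] [MeasurableSpace E] [BorelSpace E] (μ : Measure E)
    [μ.IsAddHaarMeasure] {f : E → ℝ} (hf : Continuous f) :
    Integrable (fun x : Metric.sphere (0 : E) 1 ↦ f x) μ.toSphere :=
  have : CompactSpace (Metric.sphere (0 : E) 1) :=
    isCompact_iff_compactSpace.1 (isCompact_sphere 0 1)
  (hf.comp continuous_subtype_val).integrable_of_hasCompactSupport
    (HasCompactSupport.of_compactSpace _)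

open MeasureTheory in
theorem toSphere_real_univ_pos :
    0 < (volume : Measure (EuclideanSpace ℝ (Fin 4))).toSphere.real Set.univ :=
  have : NeZero (volume : Measure (EuclideanSpace ℝ (Fin 4))).toSphere :=
    ⟨Measure.toSphere_ne_zero _⟩
  measureReal_univ_pos

open MeasureTheory in
/-- The moments of the surface measure on `S³` along a unit vector. -/
theorem integral_sphere_inner_pow {z : EuclideanSpace ℝ (Fin 4)} (hz : ‖z‖ = 1) (k : ℕ) :
    (∫ x : Metric.sphere (0 : EuclideanSpace ℝ (Fin 4)) 1, inner ℝ z (x : EuclideanSpace ℝ (Fin 4)) ^ k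
        ∂(volume : Measure (EuclideanSpace ℝ (Fin 4))).toSphere) * radialMoment (3 + k) =
      gaussMoment k * gaussMoment 0 ^ 3 := by
  -- Completing `z` to an orthonormal basis makes the zonal power a monomial in one coordinate.
  obtain ⟨b, hb⟩ := Orthonormal.exists_orthonormalBasis_extension_of_card_eq (𝕜 := ℝ)
    (E := EuclideanSpace ℝ (Fin 4)) (ι := Fin 4) (by simp) (v := fun _ ↦ z) (s := {0}) (by
      rw [orthonormal_iff_ite]
      rintro ⟨i, rfl⟩ ⟨j, rfl⟩
      simp [hz])
  have hb0 : b 0 = z := hb 0 rfl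
  have h := integral_sphere_prod_pow b (Pi.single 0 k)
  simpa [Fin.prod_univ_four, Fin.sum_univ_four, hb0, pow_succ, mul_assoc] using h

open MeasureTheory Polynomial in
/-- The average over `S³` of a polynomial in the inner product with `z`. -/
noncomputable def zonalAverage (z : EuclideanSpace ℝ (Fin 4)) : ℝ[X] →ₗ[ℝ] ℝ where
  toFun p := (1 / (volume : Measure (EuclideanSpace ℝ (Fin 4))).toSphere.real Set.univ) *
    ∫ x : Metric.sphere (0 : EuclideanSpace ℝ (Fin 4)) 1,
      p.eval (inner ℝ z (x : EuclideanSpace ℝ (Fin 4)))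
      ∂(volume : Measure (EuclideanSpace ℝ (Fin 4))).toSphere
  map_add' p q := by
    simp only [eval_add]
    rw [integral_add, mul_add]
    · exact integrable_toSphere_of_continuous _ (f := fun x ↦ p.eval (inner ℝ z x)) (by fun_prop)
    · exact integrable_toSphere_of_continuous _ (f := fun x ↦ q.eval (inner ℝ z x)) (by fun_prop)
  map_smul' c p := by
    simp only [eval_smul, smul_eq_mul, RingHom.id_apply, integral_const_mul]
    ring

open MeasureTheory in
theorem isSemicircular_zonalAverage {z : EuclideanSpace ℝ (Fin 4)} (hz : ‖z‖ = 1) :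
    IsSemicircular (zonalAverage z) where
  map_one := by
    simp only [zonalAverage, LinearMap.coe_mk, AddHom.coe_mk, Polynomial.eval_one, integral_const,
      smul_eq_mul, mul_one]
    exact one_div_mul_cancel toSphere_real_univ_pos.ne'
  map_X := by
    have h := integral_sphere_inner_pow hz 1
    rw [gaussMoment_of_odd odd_one, zero_mul] at h
    have h0 := (mul_eq_zero.1 h).resolve_right (radialMoment_pos _).ne'
    simp only [pow_one] at h0
    simp only [zonalAverage, LinearMap.coe_mk, AddHom.coe_mk, Polynomial.eval_X, h0, mul_zero]
  map_X_pow k := by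
    have h1 := integral_sphere_inner_pow hz k
    have h2 := integral_sphere_inner_pow hz (k + 2)
    have hR := radialMoment_pos (3 + k)
    -- The Gaussian moment gains the factor `(k + 1) / 2` and the radial one `(k + 4) / 2`; their
    -- quotient is the semicircle recursion.
    rw [← add_assoc, radialMoment_add_two, gaussMoment_add_two] at h2
    simp only [zonalAverage, LinearMap.coe_mk, AddHom.coe_mk, Polynomial.eval_pow,
      Polynomial.eval_X]
    rw [mul_left_comm, mul_left_comm ((k : ℝ) + 1)]
    congr 1
    refine mul_right_cancel₀ hR.ne' ?_
    push_cast at h2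
    linear_combination 2 * h2 - (k + 1) * h1

open Polynomial in
theorem totalDegree_aeval_linear_le {d : ℕ} (z : Fin d → ℝ) (p : ℝ[X]) :
    (aeval (∑ i, MvPolynomial.C (z i) * MvPolynomial.X i : MvPolynomial (Fin d) ℝ) p).totalDegree
      ≤ p.natDegree := by
  rw [aeval_eq_sum_range]
  refine (MvPolynomial.totalDegree_finsetSum _ _).trans (Finset.sup_le fun k hk ↦ ?_)
  refine (MvPolynomial.totalDegree_smul_le _ _).trans ?_
  refine (MvPolynomial.totalDegree_pow _ _).trans ?_
  have h1 : (∑ i, MvPolynomial.C (z i) * MvPolynomial.X i :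
      MvPolynomial (Fin d) ℝ).totalDegree ≤ 1 := by
    refine (MvPolynomial.totalDegree_finsetSum _ _).trans (Finset.sup_le fun i _ ↦ ?_)
    refine (MvPolynomial.totalDegree_mul _ _).trans ?_
    rw [MvPolynomial.totalDegree_C, MvPolynomial.totalDegree_X]
  have := Finset.mem_range_succ_iff.1 hk
  nlinarith

open Polynomial in
theorem eval_aeval_linear {d : ℕ} (z x : EuclideanSpace ℝ (Fin d)) (p : ℝ[X]) :
    MvPolynomial.eval (fun i ↦ x i)
      (aeval (∑ i, MvPolynomial.C (z i) * MvPolynomial.X i : MvPolynomial (Fin d) ℝ) p) =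
      p.eval (inner ℝ z x) := by
  rw [aeval_def, hom_eval₂, eval, PiLp.inner_apply]
  congr 1
  · ext r
    simp [MvPolynomial.algebraMap_eq]
  · simp [mul_comm]

open Polynomial in
theorem IsSphericalDesign.sum_eval_inner {t : ℕ} {X : Finset (EuclideanSpace ℝ (Fin 4))}
    (hX : IsSphericalDesign t X) (z : EuclideanSpace ℝ (Fin 4)) (p : ℝ[X]) (hp : p.natDegree ≤ t) :
    (1 / (X.card : ℝ)) * ∑ x ∈ X, p.eval (inner ℝ z x) = zonalAverage z p := by
  have h := hX.2.2 _ ((totalDegree_aeval_linear_le (fun i ↦ z i) p).trans hp)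
  simp only [eval_aeval_linear] at h
  exact h

/-! ### Stiffness forces `n = 1`. -/

theorem eq_one_of_isStiff {n : ℕ} (hn : 1 ≤ n) {X : Finset (EuclideanSpace ℝ (Fin 4))}
    (hX : IsStiff (2 * n) X) : n = 1 := by
  obtain ⟨hdes, z, hz, hcard⟩ := hX
  have hz1 : ‖z‖ = 1 := by simpa using hz
  -- The weights are taken in `ℚ`: their rationality is what makes `t²` rational below.
  let w : ℝ → ℚ := fun t ↦ (X.filter fun x ↦ inner ℝ z x = t).card / X.card
  obtain ⟨hD, hroot⟩ := (isSemicircular_zonalAverage hz1).quadrature (innerProducts z X) hcard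
    (fun t ↦ (w t : ℝ)) fun p hp ↦ by
      rw [← hdes.sum_eval_inner z p hp, Finset.sum_comp (fun t ↦ p.eval t), Finset.mul_sum]
      refine Finset.sum_congr rfl fun t _ ↦ ?_
      simp only [w, nsmul_eq_mul]
      push_cast
      ring
  have hsub : innerProducts z X ⊆ {1 / 2, -1 / 2} := by
    intro t ht
    obtain ⟨h0, hw⟩ := hroot t ht
    have hsum := sum_U_sq_of_root h0
    set S := ∑ j ∈ Finset.range (2 * n), (Polynomial.Chebyshev.U ℝ j).eval t ^ 2
    have hS0 : 0 ≤ S := Finset.sum_nonneg fun j _ ↦ sq_nonneg _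
    have hS : 0 < S := hS0.lt_of_ne' fun h ↦ by
      rw [h, mul_zero] at hw
      exact zero_ne_one hw
    have hpos : (0 : ℝ) < (2 * n : ℕ) + 1 := by positivity
    have h1 : t ^ 2 < 1 := by
      by_contra! h
      nlinarith
    -- Eliminates `S` between `w t * S = 1` and `2 (1 - t²) S = 2n + 1`.
    have hq : t ^ 2 = ((1 - w t * ((2 * n : ℕ) + 1) / 2 : ℚ) : ℝ) := by
      push_cast at hsum ⊢
      linear_combination -(w t / 2 : ℝ) * hsum + (1 - t ^ 2) * hw
    have h4 := sq_eq_of_U_root_of_even h0 h1 ⟨_, hq⟩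
    have : (t - 1 / 2) * (t - -1 / 2) = 0 := by linear_combination h4
    rcases mul_eq_zero.1 this with h | h <;> simp [sub_eq_zero.1 h]
  have := (Finset.card_le_card hsub).trans Finset.card_le_two
  omega

/-! ### The cross-polytope is `2`-stiff. -/

/-- The vertices of the cross-polytope in `ℝ⁴`. -/
noncomputable def crossVertex (p : Fin 4 × Bool) : EuclideanSpace ℝ (Fin 4) :=
  EuclideanSpace.single p.1 (cond p.2 1 (-1))

theorem crossVertex_injective : Function.Injective crossVertex := by
  rintro ⟨i, u⟩ ⟨j, v⟩ h
  have h1 := congrArg (fun x : EuclideanSpace ℝ (Fin 4) ↦ x i) h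
  by_cases hij : i = j
  · subst hij
    cases u <;> cases v <;> first | rfl | norm_num [crossVertex] at h1
  · cases u <;> simp [crossVertex, hij] at h1

/-- The cross-polytope in `ℝ⁴`. -/
noncomputable def crossPolytope : Finset (EuclideanSpace ℝ (Fin 4)) :=
  Finset.univ.map ⟨crossVertex, crossVertex_injective⟩

open MeasureTheory in
-- In degree at most `3`, a monomial either has an odd exponent, and both averages vanish by
-- symmetry, or is `1` or a single square, with averages `1` and `1/4`.
theorem crossPolytope_monomial (d : Fin 4 → ℕ) (hd : ∑ i, d i ≤ 3) :
    (1 / (crossPolytope.card : ℝ)) * ∑ x ∈ crossPolytope, ∏ i, x i ^ d i =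
      (1 / (volume : Measure (EuclideanSpace ℝ (Fin 4))).toSphere.real Set.univ) *
        ∫ x : Metric.sphere (0 : EuclideanSpace ℝ (Fin 4)) 1,
          ∏ i, (x : EuclideanSpace ℝ (Fin 4)) i ^ d i
          ∂(volume : Measure (EuclideanSpace ℝ (Fin 4))).toSphere := by
  have hJ := integral_sphere_prod_pow (EuclideanSpace.basisFun (Fin 4) ℝ) d
  have h0 := integral_sphere_prod_pow (EuclideanSpace.basisFun (Fin 4) ℝ) 0
  simp only [Pi.zero_apply, pow_zero, Finset.prod_const_one, integral_const, smul_eq_mul, mul_one,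
    Finset.sum_const_zero, add_zero, Fintype.card_fin, Finset.prod_const, Finset.card_univ] at h0
  simp only [EuclideanSpace.basisFun_inner, Fintype.card_fin] at hJ
  have hσ := toSphere_real_univ_pos
  set σ := (volume : Measure (EuclideanSpace ℝ (Fin 4))).toSphere.real Set.univ
  set J := ∫ x : Metric.sphere (0 : EuclideanSpace ℝ (Fin 4)) 1,
          ∏ i, (x : EuclideanSpace ℝ (Fin 4)) i ^ d i
          ∂(volume : Measure (EuclideanSpace ℝ (Fin 4))).toSphere
  have hcard : (crossPolytope.card : ℝ) = 8 := by simp [crossPolytope]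
  have g1 : gaussMoment 1 = 0 := gaussMoment_of_odd odd_one
  have g2 : gaussMoment 2 = gaussMoment 0 / 2 := by
    rw [gaussMoment_add_two]
    norm_num
    ring
  have g3 : gaussMoment 3 = 0 := gaussMoment_of_odd (by decide)
  have r3 := (radialMoment_pos 3).ne'
  have r4 := (radialMoment_pos 4).ne'
  have r6 := (radialMoment_pos 6).ne'
  have r5 : radialMoment 5 = 2 * radialMoment 3 := by rw [radialMoment_add_two]; norm_num
  -- Denominators are cleared so that each case becomes linear in `h0` and `hJ` after multiplying by
  -- `radialMoment 3`.
  suffices (∑ x ∈ crossPolytope, ∏ i, x i ^ d i) * σ = 8 * J by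
    rw [hcard]
    field_simp
    linarith
  simp only [crossPolytope, Finset.sum_map, Function.Embedding.coeFn_mk, Fintype.sum_prod_type,
    Fintype.sum_bool, Fin.sum_univ_four, Fin.prod_univ_four, crossVertex,
    PiLp.single_apply, Fin.isValue, Fin.reduceEq, if_true, if_false, cond_true, cond_false] at hd hJ ⊢
  generalize d 0 = a at *
  generalize d 1 = b at *
  generalize d 2 = c at *
  generalize d 3 = e at *
  have ha : a ≤ 3 := by omega
  have hb : b ≤ 3 := by omega
  have hc : c ≤ 3 := by omega
  have he : e ≤ 3 := by omega
  interval_cases a <;> interval_cases b <;> first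
    | omega
    | interval_cases c <;> first
      | omega
      | interval_cases e <;> first
        | omega
        | (norm_num [g1, g2, g3, r3, r4, r5, r6] at hJ ⊢
           first
             | exact hJ
             | refine mul_right_cancel₀ r3 ?_
               linear_combination h0 - hJ
             | refine mul_right_cancel₀ r3 ?_
               linear_combination 2 * h0 - 4 * hJ)

theorem isSphericalDesign_crossPolytope : IsSphericalDesign 3 crossPolytope := by
  refine ⟨by simp [crossPolytope], ?_, fun f hf ↦ ?_⟩
  · intro x hx
    obtain ⟨⟨i, u⟩, -, rfl⟩ := Finset.mem_map.1 hx
    cases u <;> simp [crossVertex]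
  · simp only [MvPolynomial.eval_eq']
    rw [MeasureTheory.integral_finsetSum, Finset.sum_comm, Finset.mul_sum, Finset.mul_sum]
    · refine Finset.sum_congr rfl fun d hd ↦ ?_
      rw [← Finset.mul_sum, MeasureTheory.integral_const_mul, mul_left_comm,
        mul_left_comm _ (MvPolynomial.coeff d f), crossPolytope_monomial]
      have := MvPolynomial.le_totalDegree hd
      rw [Finsupp.sum_fintype _ _ fun _ ↦ rfl] at this
      exact this.trans hf
    · intro d _
      exact integrable_toSphere_of_continuous _
        (f := fun x : EuclideanSpace ℝ (Fin 4) ↦ MvPolynomial.coeff d f * ∏ i, x i ^ d i)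
        (by fun_prop)

theorem isStiff_crossPolytope : IsStiff (2 * 1) crossPolytope := by
  -- This unit vector meets every vertex `±e_i` in `±1/2`, the two roots of `U 2 = 4 x² - 1`.
  refine ⟨isSphericalDesign_crossPolytope, !₂[1 / 2, 1 / 2, 1 / 2, 1 / 2], ?_, ?_⟩
  · simp [EuclideanSpace.norm_eq, Fin.sum_univ_four]
    norm_num
  · refine (Finset.card_le_card (t := {1 / 2, -1 / 2}) fun t ht ↦ ?_).trans Finset.card_le_two
    obtain ⟨x, hx, rfl⟩ := Finset.mem_image.1 ht
    obtain ⟨⟨i, u⟩, -, rfl⟩ := Finset.mem_map.1 hx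
    fin_cases i <;> cases u <;> norm_num [crossVertex, EuclideanSpace.inner_single_right]

theorem mainTheorem8 (n : ℕ) (hn : 1 ≤ n) :
    (∃ X : Finset (EuclideanSpace ℝ (Fin 4)), IsStiff (2 * n) X) ↔ n = 1 := by
  constructor
  · rintro ⟨X, hX⟩
    exact eq_one_of_isStiff hn hX
  · rintro rfl
    exact ⟨crossPolytope, isStiff_crossPolytope⟩
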